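/- Let $r\ge 1$ and let $c=(c_1,\dots,c_r)$ be a tuple of non-negative integers. A cylindric partition with profile $c$ is an $r$-tuple $\Lambda=(\lambda^{(1)},\dots,\lambda^{(r)})$ of ordinary partitions $\lambda^{(i)}=(\lambda^{(i)}_1\ge\lambda^{(i)}_2\ge\cdots)$, each continued by zeros, such that $$\lambda^{(i)}_j\ \ge\ \lambda^{(i+1)}_{j+c_{i+1}}\quad(1\le i<r),\qquad \lambda^{(r)}_j\ \ge\ \lambda^{(1)}_{j+c_1}\qquad\text{for all } j\ge 1.$$ Its size $|\Lambda|$ is the sum of all the parts of $\lambda^{(1)},\dots,\lambda^{(r)}$. For $a,q\in\mathbb{C}$ with $|q|<1$, put $(a;q)_n=\prod_{k=1}^{n}(1-aq^{k-1})$ and $(a;q)_\infty=\lim_{n\to\infty}(a;q)_n$. Theorem. For every complex $q$ with $|q|<1$, the generating function of the cylindric partitions with profile $c=(4,0)$ (rank $r=2$) is $$\sum_{\Lambda} q^{|\Lambda|}=\left(\sum_{n\ge 0}\frac{q^{n(n+1)}\,(-q^2;q^2)_n}{(-q^3;q^2)_n\,(q^2;q^2)_n}\right)\cdot\frac{(-q^3;q^2)_\infty}{(q;q)_\infty},$$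 where $\Lambda$ runs over all cylindric partitions with profile $(4,0)$ and both sums converge absolutely. -/

import Mathlib

/-- A cylindric partition of rank `r` with profile `c = (c_1, ..., c_r)`: an `r`-tuple of ordinary
partitions, each written as a non-increasing sequence of naturals followed by zeros (the parts are
the nonzero entries), such that `λ^{(i)}_j ≥ λ^{(i+1)}_{j + c_{i+1}}` for all `i`, `j`. Indices of
rows are cyclic (`i + 1` is addition modulo `r` in `Fin r`), so that the last row is compared with
the first: `λ^{(r)}_j ≥ λ^{(1)}_{j + c_1}`. Both rows and parts are indexed from `0`. -/
@[ext]
structure CylindricPartition {r : ℕ} [NeZero r] (c : Fin r → ℕ) where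
  /-- `parts i j` is the `j`-th entry of the `i`-th partition. -/
  parts : Fin r → (ℕ →₀ ℕ)
  antitone_parts : ∀ i, Antitone (parts i)
  cylindric : ∀ i j, parts (i + 1) (j + c (i + 1)) ≤ parts i j

/-- The size of a cylindric partition: the sum of all parts of all its partitions. -/
def CylindricPartition.size {r : ℕ} [NeZero r] {c : Fin r → ℕ} (Λ : CylindricPartition c) : ℕ :=
  ∑ i, (Λ.parts i).sum fun _ m => m

/-- The finite `q`-Pochhammer symbol `(a; q)_n = (1 - a)(1 - a q) ⋯ (1 - a q^(n-1))`. -/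
def qPoch (a q : ℂ) (n : ℕ) : ℂ :=
  ∏ k ∈ Finset.range n, (1 - a * q ^ k)

/-- The infinite `q`-Pochhammer symbol `(a; q)_∞ = lim_{n → ∞} (a; q)_n`, for `|q| < 1`. -/
noncomputable def qPochInf (a q : ℂ) : ℂ :=
  Filter.atTop.limUnder (qPoch a q)

/-- The limit defining `(a; q)_∞` exists for `|q| < 1`. -/
theorem tendsto_qPochInf (a q : ℂ) (hq : ‖q‖ < 1) :
    Filter.Tendsto (qPoch a q) Filter.atTop (nhds (qPochInf a q)) := by
  have hs : Summable fun k : ℕ => ‖-(a * q ^ k)‖ := by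
    simpa [norm_neg, norm_mul, norm_pow] using
      (summable_geometric_of_lt_one (norm_nonneg q) hq).mul_left ‖a‖
  have hm : Multipliable fun k : ℕ => 1 + -(a * q ^ k) := multipliable_one_add_of_summable hs
  have ht := hm.hasProd.tendsto_prod_nat
  simp only [← sub_eq_add_neg] at ht
  exact tendsto_nhds_limUnder ⟨_, ht⟩

/-! A cylindric partition of profile (4,0) is a stack of level sets, each consisting of the first a
entries of one row and the first b of the other, with b ≤ a ≤ b + 4. Let G(a,b) count those in
`leading a b`. Removing one copy of the shape (a,b) shows that the part with no such level has
generating function (1 - q^(a+b)) G(a,b) (`genFun_leading`). That part is also a union of two sets,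
so inclusion–exclusion expresses it by G at larger shapes. After normalization by a tail of (q;q)_∞
this becomes a linear system for H(a,b) = `normGenFun q a b` on the strip, with one relation on each
edge.

The system has a hidden symmetry, H(m+3,m) = H(m+2,m+1). It allows elimination down to a three-term
recurrence for H(m,m) (`normGenFun_recurrence`). With z = q^(2m), the sums F(z) = ∑ z^n q^(n(n+1))
(-q²;q²)_n / (q²;q²)_n · (-z q^(2n+3);q²)_∞ satisfy the same recurrence by telescoping
(`seriesSum_recurrence`). Both sequences tend to 1, and a null solution vanishes
(`eq_zero_of_recurrence`), so they agree. The case m = 0 is the theorem. -/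

open Filter Topology

/-! ### Infinite q-products and null solutions of recurrences. -/

theorem qPoch_succ (a q : ℂ) (n : ℕ) : qPoch a q (n + 1) = qPoch a q n * (1 - a * q ^ n) := by
  simp [qPoch, Finset.prod_range_succ]

theorem one_sub_mul_pow_ne_zero {a q : ℂ} (ha : ‖a‖ < 1) (hq : ‖q‖ < 1) (n : ℕ) :
    1 - a * q ^ n ≠ 0 := by
  intro h
  have h1 : ‖a * q ^ n‖ < 1 := by
    rw [norm_mul, norm_pow]
    exact (mul_le_of_le_one_right (norm_nonneg _) (pow_le_one₀ (norm_nonneg _) hq.le)).trans_lt ha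
  rw [← sub_eq_zero.mp h] at h1
  simp at h1

theorem qPoch_ne_zero {a q : ℂ} (ha : ‖a‖ < 1) (hq : ‖q‖ < 1) (n : ℕ) : qPoch a q n ≠ 0 :=
  Finset.prod_ne_zero_iff.mpr fun k _ => one_sub_mul_pow_ne_zero ha hq k

theorem qPochInf_ne_zero {a q : ℂ} (ha : ‖a‖ < 1) (hq : ‖q‖ < 1) : qPochInf a q ≠ 0 := by
  have hs : Summable fun k : ℕ => ‖-(a * q ^ k)‖ := by
    simpa [norm_neg, norm_mul, norm_pow] using
      (summable_geometric_of_lt_one (norm_nonneg q) hq).mul_left ‖a‖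
  have ht := (multipliable_one_add_of_summable hs).hasProd.tendsto_prod_nat
  simp only [← sub_eq_add_neg] at ht
  rw [tendsto_nhds_unique (tendsto_qPochInf a q hq) ht]
  have := tprod_one_add_ne_zero_of_summable (f := fun k : ℕ => -(a * q ^ k))
    (fun k => by simpa [← sub_eq_add_neg] using one_sub_mul_pow_ne_zero ha hq k) hs
  simpa [← sub_eq_add_neg] using this

/-- The tail `(a q^n; q)_∞` of an infinite `q`-Pochhammer symbol. -/
noncomputable def qPochTail (a q : ℂ) (n : ℕ) : ℂ := qPochInf a q / qPoch a q n

theorem qPochTail_zero (a q : ℂ) : qPochTail a q 0 = qPochInf a q := by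
  simp [qPochTail, qPoch]

theorem qPochTail_eq {a q : ℂ} (ha : ‖a‖ < 1) (hq : ‖q‖ < 1) (n : ℕ) :
    qPochTail a q n = (1 - a * q ^ n) * qPochTail a q (n + 1) := by
  have h1 := qPoch_ne_zero ha hq n
  have h2 := one_sub_mul_pow_ne_zero ha hq n
  rw [qPochTail, qPochTail, qPoch_succ]
  field_simp

theorem tendsto_qPochTail {a q : ℂ} (ha : ‖a‖ < 1) (hq : ‖q‖ < 1) :
    Tendsto (qPochTail a q) atTop (𝓝 1) := by
  have h := (tendsto_const_nhds (x := qPochInf a q)).div (tendsto_qPochInf a q hq)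
    (qPochInf_ne_zero ha hq)
  rwa [div_self (qPochInf_ne_zero ha hq)] at h

theorem eq_zero_of_norm_le_succ {E : Type*} [NormedAddCommGroup E] {u : ℕ → E}
    (h : ∀ m, ‖u m‖ ≤ ‖u (m + 1)‖) (hu : Tendsto u atTop (𝓝 0)) (m : ℕ) : u m = 0 := by
  have h1 := (monotone_nat_of_le_succ h).ge_of_tendsto hu.norm m
  simpa using h1

/-- A null sequence satisfying a three-term recurrence that is a summable perturbation of
`u m = u (m + 1)` vanishes. -/
theorem eq_zero_of_recurrence {α β u : ℕ → ℂ} (hα : Summable α) (hβ : Summable β)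
    (h : ∀ m, u m = (1 + α m) * u (m + 1) + β m * u (m + 2))
    (hu : Tendsto u atTop (𝓝 0)) (m : ℕ) : u m = 0 := by
  set γ : ℕ → ℝ := fun m => ‖α m‖ + ‖β m‖ with hγ
  have hγs : Summable γ := hα.norm.add hβ.norm
  have hγ0 : ∀ m, 0 ≤ γ m := fun m => by positivity
  set M : ℕ → ℝ := fun m => max ‖u m‖ ‖u (m + 1)‖ with hM
  have hM0 : ∀ m, 0 ≤ M m := fun m => le_max_of_le_left (norm_nonneg _)
  have hstep : ∀ m, M m ≤ (1 + γ m) * M (m + 1) := by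
    intro m
    have h1 : ‖u (m + 1)‖ ≤ M (m + 1) := le_max_left _ _
    have h2 : ‖u (m + 2)‖ ≤ M (m + 1) := le_max_right _ _
    refine max_le ?_ ?_
    · rw [h m]
      calc ‖(1 + α m) * u (m + 1) + β m * u (m + 2)‖
          ≤ (1 + ‖α m‖) * ‖u (m + 1)‖ + ‖β m‖ * ‖u (m + 2)‖ := by
            refine (norm_add_le _ _).trans ?_
            rw [norm_mul, norm_mul]
            gcongr
            simpa using norm_add_le (1 : ℂ) (α m)
        _ ≤ (1 + ‖α m‖) * M (m + 1) + ‖β m‖ * M (m + 1) := by gcongr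
        _ = (1 + γ m) * M (m + 1) := by simp only [hγ]; ring
    · nlinarith [hγ0 m, hM0 (m + 1), mul_nonneg (hγ0 m) (hM0 (m + 1))]
  set p : ℕ → ℝ := fun m => ∏ i ∈ Finset.range m, (1 + γ i) with hp
  have hp0 : ∀ m, 1 ≤ p m := fun m =>
    Finset.prod_induction _ (1 ≤ ·) (fun _ _ => one_le_mul_of_one_le_of_one_le) le_rfl
      fun i _ => by linarith [hγ0 i]
  -- The weights p absorb the factors 1 + γ and stay bounded since γ is summable. A nondecreasing
  -- nonnegative sequence with limit 0 is zero.
  have hmono : Monotone fun m => p m * M m := by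
    refine monotone_nat_of_le_succ fun m => ?_
    have : p (m + 1) = p m * (1 + γ m) := Finset.prod_range_succ _ _
    rw [this, mul_assoc]
    exact mul_le_mul_of_nonneg_left (hstep m) (by linarith [hp0 m])
  have hplim : Tendsto p atTop (𝓝 (∏' i, (1 + γ i))) :=
    (multipliable_one_add_of_summable hγs.norm).hasProd.tendsto_prod_nat
  have hMlim : Tendsto M atTop (𝓝 0) := by
    have := hu.norm.max (hu.comp (tendsto_add_atTop_nat 1)).norm
    simpa using this
  have hlim := hplim.mul hMlim
  rw [mul_zero] at hlim
  have h1 : p m * M m ≤ 0 := hmono.ge_of_tendsto hlim m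
  have h2 : ‖u m‖ ≤ M m := le_max_left _ _
  have h3 : ‖u m‖ ≤ 0 := by nlinarith [hp0 m, hM0 m]
  simpa using h3

/-! ### The q-series side and its q-difference equation. -/

section Series

variable {q : ℂ}

theorem norm_pow_lt_one (hq : ‖q‖ < 1) {k : ℕ} (hk : k ≠ 0) : ‖q ^ k‖ < 1 := by
  rw [norm_pow]; exact pow_lt_one₀ (norm_nonneg _) hq hk

theorem norm_neg_pow_lt_one (hq : ‖q‖ < 1) {k : ℕ} (hk : k ≠ 0) : ‖-q ^ k‖ < 1 := by
  rw [norm_neg]; exact norm_pow_lt_one hq hk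

/-- The coefficient `q^(n(n+1)) (-q²; q²)_n / (q²; q²)_n`. -/
noncomputable def seriesCoeff (q : ℂ) (n : ℕ) : ℂ :=
  q ^ (n * (n + 1)) * qPoch (-q ^ 2) (q ^ 2) n / qPoch (q ^ 2) (q ^ 2) n

theorem seriesCoeff_succ (hq : ‖q‖ < 1) (n : ℕ) :
    seriesCoeff q (n + 1) * (1 - q ^ (2 * (n + 1))) =
      seriesCoeff q n * (q ^ (2 * (n + 1)) * (1 + q ^ (2 * (n + 1)))) := by
  have hQ := norm_pow_lt_one hq two_ne_zero
  have h1 := qPoch_ne_zero hQ hQ n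
  have h2 := one_sub_mul_pow_ne_zero hQ hQ n
  have h3 : 1 - q ^ 2 * (q ^ 2) ^ n = 1 - q ^ (2 * (n + 1)) := by ring
  rw [seriesCoeff, seriesCoeff, qPoch_succ, qPoch_succ, ← h3]
  field_simp
  ring

/-- The Pochhammer quotients and tails converge, hence are bounded, and |q|^(n(n+1)) ≤ |q|^n. The
bound is uniform in k, as dominated convergence in m requires. -/
theorem exists_norm_seriesCoeff_mul_le (hq : ‖q‖ < 1) :
    ∃ C : ℝ, ∀ n k, ‖seriesCoeff q n * qPochTail (-q ^ 3) (q ^ 2) k‖ ≤ C * ‖q‖ ^ n := by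
  have hQ := norm_pow_lt_one hq two_ne_zero
  have h1 : Tendsto (fun n => qPoch (-q ^ 2) (q ^ 2) n / qPoch (q ^ 2) (q ^ 2) n) atTop _ :=
    (tendsto_qPochInf _ _ hQ).div (tendsto_qPochInf _ _ hQ) (qPochInf_ne_zero hQ hQ)
  obtain ⟨B, hB⟩ := (Metric.isBounded_range_of_tendsto _ h1).exists_norm_le
  obtain ⟨C, hC⟩ := (Metric.isBounded_range_of_tendsto _
    (tendsto_qPochTail (norm_neg_pow_lt_one hq three_ne_zero) hQ)).exists_norm_le
  refine ⟨B * C, fun n k => ?_⟩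
  have hB' := hB _ ⟨n, rfl⟩
  have hC' := hC _ ⟨k, rfl⟩
  have h2 : ‖q‖ ^ (n * (n + 1)) ≤ ‖q‖ ^ n :=
    pow_le_pow_of_le_one (norm_nonneg _) hq.le (by nlinarith)
  rw [seriesCoeff, mul_div_assoc, norm_mul, norm_mul, norm_pow]
  have hB0 : 0 ≤ B := (norm_nonneg _).trans hB'
  calc _ ≤ ‖q‖ ^ n * B * C := by gcongr
    _ = _ := by ring

/-- The `n`-th term of the series `∑ z^n q^(n(n+1)) (-q²; q²)_n / (q²; q²)_n * (-z q^(2n+3); q²)_∞`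
at `z = q^(2m)`. -/
noncomputable def seriesTerm (q : ℂ) (m n : ℕ) : ℂ :=
  q ^ (2 * m * n) * (seriesCoeff q n * qPochTail (-q ^ 3) (q ^ 2) (m + n))

theorem exists_norm_seriesTerm_le (hq : ‖q‖ < 1) :
    ∃ C : ℝ, ∀ m n, ‖seriesTerm q m n‖ ≤ C * ‖q‖ ^ n := by
  obtain ⟨C, hC⟩ := exists_norm_seriesCoeff_mul_le hq
  refine ⟨C, fun m n => ?_⟩
  rw [seriesTerm, norm_mul]
  exact (mul_le_of_le_one_left (norm_nonneg _)
    (by rw [norm_pow]; exact pow_le_one₀ (norm_nonneg _) hq.le)).trans (hC n (m + n))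

theorem summable_mul_norm_pow (hq : ‖q‖ < 1) (C : ℝ) : Summable fun n : ℕ => C * ‖q‖ ^ n :=
  (summable_geometric_of_lt_one (norm_nonneg q) hq).mul_left C

theorem summable_seriesTerm (hq : ‖q‖ < 1) (m : ℕ) : Summable (seriesTerm q m) := by
  obtain ⟨C, hC⟩ := exists_norm_seriesTerm_le hq
  exact Summable.of_norm_bounded (summable_mul_norm_pow hq C) (hC m)

/-- The sum of `seriesTerm`. -/
noncomputable def seriesSum (q : ℂ) (m : ℕ) : ℂ := ∑' n, seriesTerm q m n

theorem tendsto_seriesSum (hq : ‖q‖ < 1) : Tendsto (seriesSum q) atTop (𝓝 1) := by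
  obtain ⟨C, hC⟩ := exists_norm_seriesTerm_le hq
  have hQ := norm_pow_lt_one hq two_ne_zero
  have hE := tendsto_qPochTail (norm_neg_pow_lt_one hq three_ne_zero) hQ
  have h : Tendsto (seriesSum q) atTop (𝓝 (∑' n : ℕ, if n = 0 then (1 : ℂ) else 0)) := by
    refine tendsto_tsum_of_dominated_convergence (summable_mul_norm_pow hq C) (fun n => ?_)
      (Eventually.of_forall fun m n => hC m n)
    have hEn := hE.comp (tendsto_add_atTop_nat n)
    rcases eq_or_ne n 0 with rfl | hn
    · simpa [seriesTerm, seriesCoeff, qPoch] using hE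
    · have h1 : Tendsto (fun m : ℕ => (q ^ (2 * n)) ^ m) atTop (𝓝 0) :=
        tendsto_pow_atTop_nhds_zero_of_norm_lt_one (norm_pow_lt_one hq (by omega))
      have h2 := h1.mul (hEn.const_mul (seriesCoeff q n))
      rw [zero_mul] at h2
      rw [if_neg hn]
      refine h2.congr fun m => ?_
      simp only [seriesTerm, Function.comp_apply, ← pow_mul]
      ring_nf
  simpa using h

/-- At z = q^(2m) this reads F(z) = (1 + zq² + zq³) F(zq²) + zq⁴(1 - zq³) F(zq⁴). Termwise the
defect is a difference g(n+1) - g(n). -/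
theorem seriesSum_recurrence (hq : ‖q‖ < 1) (m : ℕ) :
    seriesSum q m = (1 + (q ^ (2 * m + 2) + q ^ (2 * m + 3))) * seriesSum q (m + 1) +
      q ^ (2 * m + 4) * (1 - q ^ (2 * m + 3)) * seriesSum q (m + 2) := by
  have hQ := norm_pow_lt_one hq two_ne_zero
  have h3 := norm_neg_pow_lt_one hq three_ne_zero
  obtain ⟨C, hC⟩ := exists_norm_seriesCoeff_mul_le hq
  -- The telescoping certificate. The factor 1 - q^(2n) gives g(0) = 0, and in g(n+1) it is what
  -- `seriesCoeff_succ` needs to return to the n-th coefficient.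
  set g : ℕ → ℂ := fun n => -(q ^ (2 * m * n) * (1 - q ^ (2 * n)) *
    (seriesCoeff q n * qPochTail (-q ^ 3) (q ^ 2) (m + n + 1))) with hg
  have hg0 : Tendsto g atTop (𝓝 0) := by
    have hb : Tendsto (fun n : ℕ => 2 * C * ‖q‖ ^ n) atTop (𝓝 0) := by
      simpa using (tendsto_pow_atTop_nhds_zero_of_lt_one (norm_nonneg q) hq).const_mul (2 * C)
    refine squeeze_zero_norm (fun n => ?_) hb
    have h1 : ‖q ^ (2 * m * n)‖ ≤ 1 := by
      rw [norm_pow]; exact pow_le_one₀ (norm_nonneg _) hq.le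
    have h2 : ‖1 - q ^ (2 * n)‖ ≤ 2 := by
      refine (norm_sub_le _ _).trans ?_
      rw [norm_one, norm_pow]
      linarith [pow_le_one₀ (n := 2 * n) (norm_nonneg q) hq.le]
    simp only [hg]
    rw [norm_neg, norm_mul, norm_mul]
    calc _ ≤ 1 * 2 * (C * ‖q‖ ^ n) := by gcongr; exact hC _ _
      _ = _ := by ring
  have hs0 := summable_seriesTerm hq m
  have hs1 := (summable_seriesTerm hq (m + 1)).mul_left (1 + (q ^ (2 * m + 2) + q ^ (2 * m + 3)))
  have hs2 := (summable_seriesTerm hq (m + 2)).mul_left (q ^ (2 * m + 4) * (1 - q ^ (2 * m + 3)))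
  have hterm : ∀ n, seriesTerm q m n -
      (1 + (q ^ (2 * m + 2) + q ^ (2 * m + 3))) * seriesTerm q (m + 1) n -
      q ^ (2 * m + 4) * (1 - q ^ (2 * m + 3)) * seriesTerm q (m + 2) n = g (n + 1) - g n := by
    intro n
    have e0 := qPochTail_eq h3 hQ (m + n)
    have e1 := qPochTail_eq h3 hQ (m + n + 1)
    have ha := seriesCoeff_succ hq n
    have hg1 : g (n + 1) = -(q ^ (2 * m * (n + 1)) * (seriesCoeff q (n + 1) *
        (1 - q ^ (2 * (n + 1)))) * qPochTail (-q ^ 3) (q ^ 2) (m + n + 1 + 1)) := by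
      simp only [hg, ← add_assoc]; ring
    rw [hg1, ha]
    simp only [hg, seriesTerm]
    rw [show m + 1 + n = m + n + 1 by ring, show m + 2 + n = m + n + 1 + 1 by ring, e0, e1]
    ring
  have htel : Tendsto (fun N => ∑ n ∈ Finset.range N, (g (n + 1) - g n)) atTop (𝓝 0) := by
    simp_rw [Finset.sum_range_sub]
    simpa [hg] using hg0
  have hsum := ((hs0.sub hs1).sub hs2).hasSum.tendsto_sum_nat
  simp_rw [hterm] at hsum
  have hz := tendsto_nhds_unique hsum htel
  simp_rw [← hterm] at hz
  rw [(hs0.sub hs1).tsum_sub hs2, hs0.tsum_sub hs1, tsum_mul_left, tsum_mul_left] at hz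
  simp only [seriesSum]
  linear_combination hz

theorem eq_seriesSum_of_recurrence (hq : ‖q‖ < 1) {u : ℕ → ℂ}
    (h : ∀ m, u m = (1 + (q ^ (2 * m + 2) + q ^ (2 * m + 3))) * u (m + 1) +
      q ^ (2 * m + 4) * (1 - q ^ (2 * m + 3)) * u (m + 2))
    (hu : Tendsto u atTop (𝓝 1)) (m : ℕ) : u m = seriesSum q m := by
  have hQ : Summable fun m : ℕ => (q ^ 2) ^ m :=
    summable_geometric_of_norm_lt_one (norm_pow_lt_one hq two_ne_zero)
  have hQ2 : Summable fun m : ℕ => (q ^ 4) ^ m :=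
    summable_geometric_of_norm_lt_one (norm_pow_lt_one hq four_ne_zero)
  have hα : Summable fun m : ℕ => q ^ (2 * m + 2) + q ^ (2 * m + 3) :=
    (hQ.mul_left (q ^ 2 + q ^ 3)).congr fun m => by ring
  have hβ : Summable fun m : ℕ => q ^ (2 * m + 4) * (1 - q ^ (2 * m + 3)) :=
    ((hQ.mul_left (q ^ 4)).sub (hQ2.mul_left (q ^ 7))).congr fun m => by ring
  have hlim := hu.sub (tendsto_seriesSum hq)
  rw [sub_self] at hlim
  refine sub_eq_zero.mp (eq_zero_of_recurrence (u := fun m => u m - seriesSum q m) hα hβ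
    (fun m => ?_) hlim m)
  linear_combination h m - seriesSum_recurrence hq m

theorem seriesTerm_zero (n : ℕ) :
    seriesTerm q 0 n = q ^ (n * (n + 1)) * qPoch (-q ^ 2) (q ^ 2) n /
      (qPoch (-q ^ 3) (q ^ 2) n * qPoch (q ^ 2) (q ^ 2) n) * qPochInf (-q ^ 3) (q ^ 2) := by
  simp only [seriesTerm, seriesCoeff, qPochTail, mul_zero, zero_mul, pow_zero, one_mul, zero_add]
  rw [div_mul_div_comm, div_mul_eq_mul_div, mul_comm (qPoch (q ^ 2) (q ^ 2) n)]

end Series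


/-! ### Absolute convergence of the partition generating function. -/

/-- Abel summation: the difference at index j counts the columns of height j + 1 in the Young
diagram whose rows are the parts. -/
theorem sum_range_succ_mul_sub_succ {f : ℕ → ℕ} (hf : Antitone f) (N : ℕ) :
    ∑ j ∈ Finset.range N, (j + 1) * (f j - f (j + 1)) + N * f N = ∑ j ∈ Finset.range N, f j := by
  induction N with
  | zero => simp
  | succ N ih =>
    rw [Finset.sum_range_succ, Finset.sum_range_succ, ← ih]
    obtain ⟨d, hd⟩ := Nat.exists_eq_add_of_le (hf N.le_succ)
    rw [hd, Nat.add_sub_cancel_left]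
    ring

/-- The differences of consecutive terms of a finitely supported sequence. -/
noncomputable def Finsupp.consecutiveSub (f : ℕ →₀ ℕ) : ℕ →₀ ℕ :=
  Finsupp.onFinset f.support (fun j => f j - f (j + 1)) fun j hj => by
    rw [Finsupp.mem_support_iff]; omega

theorem Finsupp.consecutiveSub_apply (f : ℕ →₀ ℕ) (j : ℕ) :
    f.consecutiveSub j = f j - f (j + 1) := rfl

theorem Finsupp.exists_forall_le_eq_zero (f : ℕ →₀ ℕ) : ∃ N, ∀ j, N ≤ j → f j = 0 := by
  obtain ⟨N, hN⟩ := f.support.bddAbove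
  refine ⟨N + 1, fun j hj => ?_⟩
  by_contra h
  have := hN (Finsupp.mem_support_iff.mpr h)
  omega

theorem Finsupp.sum_eq_sum_range {f : ℕ →₀ ℕ} {N : ℕ} (hN : ∀ j, N ≤ j → f j = 0)
    {w : ℕ → ℕ → ℕ} (hw : ∀ j, w j 0 = 0) : f.sum w = ∑ j ∈ Finset.range N, w j (f j) := by
  refine Finsupp.sum_of_support_subset _ (fun j hj => ?_) _ fun j _ => hw j
  rw [Finset.mem_range]
  by_contra h
  exact Finsupp.mem_support_iff.mp hj (hN j (by omega))

theorem Finsupp.sum_consecutiveSub {f : ℕ →₀ ℕ} (hf : Antitone f) :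
    (f.consecutiveSub.sum fun j d => (j + 1) * d) = f.sum fun _ d => d := by
  obtain ⟨N, hN⟩ := f.exists_forall_le_eq_zero
  have hN' : ∀ j, N ≤ j → f.consecutiveSub j = 0 := fun j hj => by
    rw [Finsupp.consecutiveSub_apply, hN j hj, Nat.zero_sub]
  rw [Finsupp.sum_eq_sum_range hN' fun _ => mul_zero _, Finsupp.sum_eq_sum_range hN fun _ => rfl,
    ← sum_range_succ_mul_sub_succ hf N, hN N le_rfl]
  simp [Finsupp.consecutiveSub_apply]

/-- The sequence is rebuilt backwards from its zero tail; antitonicity makes the truncated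
subtraction exact. -/
theorem Finsupp.consecutiveSub_injOn : Set.InjOn Finsupp.consecutiveSub {f | Antitone f} := by
  intro f hf g hg h
  obtain ⟨N, hN⟩ := f.exists_forall_le_eq_zero
  obtain ⟨N', hN'⟩ := g.exists_forall_le_eq_zero
  have key : ∀ k j, N + N' ≤ j + k → f j = g j := by
    intro k
    induction k with
    | zero => intro j hj; rw [hN j (by omega), hN' j (by omega)]
    | succ k ih =>
      intro j hj
      have h1 := ih (j + 1) (by omega)
      have h2 := DFunLike.congr_fun h j
      rw [Finsupp.consecutiveSub_apply, Finsupp.consecutiveSub_apply] at h2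
      have h3 := hf j.le_succ
      have h4 := hg j.le_succ
      simp only [Nat.succ_eq_add_one] at h3 h4
      omega
  ext j
  exact key (N + N') j (by omega)

/-- The generating function of partitions converges absolutely in the unit disc. -/
theorem summable_pow_sum_antitone {r : ℝ} (hr0 : 0 ≤ r) (hr : r < 1) :
    Summable fun f : {f : ℕ →₀ ℕ // Antitone f} => r ^ (f.1.sum fun _ m => m) := by
  -- A partition is encoded by the finite set of pairs (j, d) with nonzero difference d at j, so its
  -- weight is a product of values of g. The value 0 at d = 0, never used by a graph, keeps g
  -- summable. For d ≥ 1, (j+1)d ≥ j + d.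
  set g : ℕ × ℕ → ℝ := fun p => if p.2 = 0 then 0 else r ^ ((p.1 + 1) * p.2) with hg
  have hgs : Summable g := by
    have hgeo := summable_geometric_of_lt_one hr0 hr
    refine Summable.of_nonneg_of_le (fun p => ?_) (fun p => ?_)
      (hgeo.mul_of_nonneg hgeo (fun _ => pow_nonneg hr0 _) fun _ => pow_nonneg hr0 _)
    · simp only [hg]; split_ifs <;> positivity
    · simp only [hg]
      split_ifs with h
      · positivity
      · rw [← pow_add]
        refine pow_le_pow_of_le_one hr0 hr.le ?_
        have : 1 ≤ p.2 := Nat.one_le_iff_ne_zero.mpr h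
        nlinarith
  have hinj : Function.Injective
      fun f : {f : ℕ →₀ ℕ // Antitone f} => f.1.consecutiveSub.graph := fun f g h =>
    Subtype.ext (Finsupp.consecutiveSub_injOn f.2 g.2 (Finsupp.graph_injective _ _ h))
  refine ((summable_finsetProd_of_summable_norm hgs.norm).comp_injective hinj).congr fun f => ?_
  rw [← Finsupp.sum_consecutiveSub f.2, Finsupp.sum, ← Finset.prod_pow_eq_pow_sum]
  simp only [Function.comp_apply, Finsupp.graph, Finset.prod_map]
  refine Finset.prod_congr rfl fun j hj => ?_
  exact if_neg (Finsupp.mem_support_iff.mp hj)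

/-! ### Cylindric partitions of profile (4,0) and their level sets. -/

namespace CylindricPartition

theorem parts_one_le (Λ : CylindricPartition ![4, 0]) (j : ℕ) : Λ.parts 1 j ≤ Λ.parts 0 j := by
  simpa using Λ.cylindric 0 j

theorem parts_zero_add_four_le (Λ : CylindricPartition ![4, 0]) (j : ℕ) :
    Λ.parts 0 (j + 4) ≤ Λ.parts 1 j := by
  simpa using Λ.cylindric 1 j

/-- A pair of partitions satisfying the two interlacing conditions for profile `(4, 0)`. -/
def ofPair (f g : ℕ →₀ ℕ) (hf : Antitone f) (hg : Antitone g) (h1 : ∀ j, g j ≤ f j)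
    (h2 : ∀ j, f (j + 4) ≤ g j) : CylindricPartition ![4, 0] where
  parts := ![f, g]
  antitone_parts i := by fin_cases i <;> assumption
  cylindric i j := by
    fin_cases i
    · simpa using h1 j
    · simpa using h2 j

theorem ext_pair {Λ Μ : CylindricPartition ![4, 0]} (h0 : ∀ j, Λ.parts 0 j = Μ.parts 0 j)
    (h1 : ∀ j, Λ.parts 1 j = Μ.parts 1 j) : Λ = Μ := by
  ext i j
  fin_cases i
  · exact h0 j
  · exact h1 j

theorem size_eq (Λ : CylindricPartition ![4, 0]) :
    Λ.size = ((Λ.parts 0).sum fun _ m => m) + (Λ.parts 1).sum fun _ m => m := by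
  simp [size, Fin.sum_univ_two]

theorem summable_norm_pow_size {q : ℂ} (hq : ‖q‖ < 1) :
    Summable fun Λ : CylindricPartition ![4, 0] => ‖q ^ Λ.size‖ := by
  have h := summable_pow_sum_antitone (norm_nonneg q) hq
  have h2 := h.mul_of_nonneg h (fun _ => by positivity) fun _ => by positivity
  have hinj : Function.Injective fun Λ : CylindricPartition ![4, 0] =>
      ((⟨Λ.parts 0, Λ.antitone_parts 0⟩, ⟨Λ.parts 1, Λ.antitone_parts 1⟩) :
        {f : ℕ →₀ ℕ // Antitone f} × {f : ℕ →₀ ℕ // Antitone f}) := by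
    intro Λ Μ hΛ
    simp only [Prod.mk.injEq, Subtype.mk.injEq] at hΛ
    exact ext_pair (DFunLike.congr_fun hΛ.1) (DFunLike.congr_fun hΛ.2)
  refine (h2.comp_injective hinj).congr fun Λ => ?_
  simp [size_eq, norm_pow, pow_add]

/-- The cylindric partitions all of whose level sets contain the first `a` entries of the first
row and the first `b` entries of the second one. -/
def leading (a b : ℕ) : Set (CylindricPartition ![4, 0]) :=
  {Λ | (∀ j < a, Λ.parts 0 j = Λ.parts 0 0) ∧ ∀ j < b, Λ.parts 1 j = Λ.parts 0 0}

/-- The members of `leading a b` none of whose level sets is exactly that set of entries. -/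
def strictLeading (a b : ℕ) : Set (CylindricPartition ![4, 0]) :=
  leading (a + 1) b ∪ leading a (b + 1)

theorem leading_inter (a b : ℕ) :
    leading (a + 1) b ∩ leading a (b + 1) = leading (a + 1) (b + 1) := by
  ext Λ
  simp only [leading, Set.mem_inter_iff, Set.mem_ofPred_eq, Nat.lt_succ_iff]
  constructor
  · rintro ⟨⟨h1, -⟩, -, h2⟩; exact ⟨h1, h2⟩
  · rintro ⟨h1, h2⟩
    exact ⟨⟨h1, fun j hj => h2 j hj.le⟩, fun j hj => h1 j hj.le, h2⟩

theorem strictLeading_subset (a b : ℕ) : strictLeading a b ⊆ leading a b := by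
  rintro Λ (⟨h1, h2⟩ | ⟨h1, h2⟩)
  · exact ⟨fun j hj => h1 j (by omega), h2⟩
  · exact ⟨h1, fun j hj => h2 j (by omega)⟩

theorem parts_zero_le (Λ : CylindricPartition ![4, 0]) (j : ℕ) : Λ.parts 0 j ≤ Λ.parts 0 0 :=
  Λ.antitone_parts 0 (Nat.zero_le j)

theorem parts_one_le_zero (Λ : CylindricPartition ![4, 0]) (j : ℕ) :
    Λ.parts 1 j ≤ Λ.parts 0 0 := (Λ.parts_one_le j).trans (Λ.parts_zero_le j)

/-- On the edge a = b the second row cannot grow alone: its maximal entries force the entries above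
them in the first row. -/
theorem leading_diag_subset (a : ℕ) : leading a (a + 1) ⊆ leading (a + 1) a := by
  rintro Λ ⟨h1, h2⟩
  refine ⟨fun j hj => le_antisymm (Λ.parts_zero_le j) ?_, fun j hj => h2 j (by omega)⟩
  rw [← h2 j hj]
  exact Λ.parts_one_le j

/-- On the edge a = b + 4 the first row cannot grow alone, by the inequality with shift 4. -/
theorem leading_add_four_subset (b : ℕ) : leading (b + 5) b ⊆ leading (b + 4) (b + 1) := by
  rintro Λ ⟨h1, h2⟩
  refine ⟨fun j hj => h1 j (by omega), fun j hj => le_antisymm (Λ.parts_one_le_zero j) ?_⟩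
  rw [← h1 (j + 4) (by omega)]
  exact Λ.parts_zero_add_four_le j

theorem strictLeading_zero : strictLeading 0 0 = Set.univ := by
  refine Set.eq_univ_of_forall fun Λ => Or.inl ⟨fun j hj => ?_, fun j hj => ?_⟩
  · rw [Nat.lt_one_iff.mp hj]
  · omega

theorem mem_strictLeading_iff {a b : ℕ} {Λ : CylindricPartition ![4, 0]} (h : Λ ∈ leading a b) :
    Λ ∈ strictLeading a b ↔ Λ.parts 0 a = Λ.parts 0 0 ∨ Λ.parts 1 b = Λ.parts 0 0 := by
  obtain ⟨h1, h2⟩ := h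
  simp only [strictLeading, leading, Set.mem_union, Set.mem_ofPred_eq]
  constructor
  · rintro (h | h)
    · exact Or.inl (h.1 a a.lt_succ_self)
    · exact Or.inr (h.2 b b.lt_succ_self)
  · rintro (h | h)
    · refine Or.inl ⟨fun j hj => ?_, h2⟩
      rcases Nat.lt_succ_iff_lt_or_eq.mp hj with hj | rfl
      exacts [h1 j hj, h]
    · refine Or.inr ⟨h1, fun j hj => ?_⟩
      rcases Nat.lt_succ_iff_lt_or_eq.mp hj with hj | rfl
      exacts [h2 j hj, h]

/-- The sequence of `n` ones followed by zeros. -/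
noncomputable def ones (n : ℕ) : ℕ →₀ ℕ := Finsupp.indicator (Finset.range n) fun _ _ => 1

theorem ones_apply (n j : ℕ) : ones n j = if j < n then 1 else 0 := by
  simp [ones, Finsupp.indicator_apply]

theorem ones_sum (n : ℕ) : ((ones n).sum fun _ m => m) = n := by
  rw [Finsupp.sum_eq_sum_range (N := n) (fun j hj => ?_) fun _ => rfl]
  · rw [Finset.sum_congr rfl fun j hj => ?_, Finset.sum_const, Finset.card_range, smul_eq_mul,
      mul_one]
    rw [ones_apply, if_pos (Finset.mem_range.mp hj)]
  · rw [ones_apply, if_neg (by omega)]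

/-- Adding one to the first `a` entries of the first row and the first `b` entries of the second
one. -/
noncomputable def addOnes {a b : ℕ} (hab : b ≤ a) (hab' : a ≤ b + 4)
    (Λ : CylindricPartition ![4, 0]) : CylindricPartition ![4, 0] :=
  ofPair (Λ.parts 0 + ones a) (Λ.parts 1 + ones b)
    (fun i j hij => by
      have := Λ.antitone_parts 0 hij
      simp only [Finsupp.add_apply, ones_apply]
      split_ifs <;> omega)
    (fun i j hij => by
      have := Λ.antitone_parts 1 hij
      simp only [Finsupp.add_apply, ones_apply]
      split_ifs <;> omega)
    (fun j => by
      have := Λ.parts_one_le j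
      simp only [Finsupp.add_apply, ones_apply]
      split_ifs <;> omega)
    (fun j => by
      have := Λ.parts_zero_add_four_le j
      simp only [Finsupp.add_apply, ones_apply]
      split_ifs <;> omega)

/-! ### Inserting and removing one level set. -/

section AddOnes

variable {a b : ℕ} (hab : b ≤ a) (hab' : a ≤ b + 4)

theorem addOnes_parts_zero (Λ : CylindricPartition ![4, 0]) (j : ℕ) :
    (addOnes hab hab' Λ).parts 0 j = Λ.parts 0 j + if j < a then 1 else 0 := by
  rw [← ones_apply]; rfl

theorem addOnes_parts_one (Λ : CylindricPartition ![4, 0]) (j : ℕ) :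
    (addOnes hab hab' Λ).parts 1 j = Λ.parts 1 j + if j < b then 1 else 0 := by
  rw [← ones_apply]; rfl

theorem size_addOnes (Λ : CylindricPartition ![4, 0]) :
    (addOnes hab hab' Λ).size = Λ.size + (a + b) := by
  have h0 : (addOnes hab hab' Λ).parts 0 = Λ.parts 0 + ones a := rfl
  have h1 : (addOnes hab hab' Λ).parts 1 = Λ.parts 1 + ones b := rfl
  rw [size_eq, size_eq, h0, h1, Finsupp.sum_add_index' (fun _ => rfl) (fun _ _ _ => rfl),
    Finsupp.sum_add_index' (fun _ => rfl) (fun _ _ _ => rfl), ones_sum, ones_sum]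
  ring

theorem addOnes_injective : Function.Injective (addOnes hab hab') := by
  intro Λ Μ h
  refine ext_pair (fun j => ?_) fun j => ?_
  · have := congrArg (fun Ν => Ν.parts 0 j) h
    simpa [addOnes_parts_zero] using this
  · have := congrArg (fun Ν => Ν.parts 1 j) h
    simpa [addOnes_parts_one] using this

/-- Inserting the shape puts a gap between the maximum and all other entries; conversely such a gap
leaves room to subtract one without breaking any inequality. The condition 0 < a ensures that the
maximum itself, the first entry of the first row, is raised. -/
theorem addOnes_image (ha : 0 < a) :
    addOnes hab hab' '' leading a b = leading a b \ strictLeading a b := by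
  apply Set.Subset.antisymm
  · rintro _ ⟨Λ, ⟨h1, h2⟩, rfl⟩
    have hmem : addOnes hab hab' Λ ∈ leading a b := by
      refine ⟨fun j hj => ?_, fun j hj => ?_⟩
      · simp [addOnes_parts_zero, ha, hj, h1 j hj]
      · simp [addOnes_parts_zero, addOnes_parts_one, ha, hj, h2 j hj]
    refine ⟨hmem, ?_⟩
    rw [mem_strictLeading_iff hmem]
    have h3 := Λ.parts_zero_le a
    have h4 := Λ.parts_one_le_zero b
    simp only [addOnes_parts_zero, addOnes_parts_one, lt_irrefl, if_false, ha, if_true]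
    omega
  · rintro Λ ⟨hΛ, hns⟩
    rw [mem_strictLeading_iff hΛ, not_or] at hns
    obtain ⟨h1, h2⟩ := hΛ
    have h3 := lt_of_le_of_ne (Λ.parts_zero_le a) hns.1
    have h4 := lt_of_le_of_ne (Λ.parts_one_le_zero b) hns.2
    have ha0 : ∀ j, a ≤ j → Λ.parts 0 j < Λ.parts 0 0 := fun j hj =>
      (Λ.antitone_parts 0 hj).trans_lt h3
    have hb0 : ∀ j, b ≤ j → Λ.parts 1 j < Λ.parts 0 0 := fun j hj =>
      (Λ.antitone_parts 1 hj).trans_lt h4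
    refine ⟨ofPair (Λ.parts 0 - ones a) (Λ.parts 1 - ones b) (fun i j hij => ?_)
      (fun i j hij => ?_) (fun j => ?_) (fun j => ?_), ⟨fun j hj => ?_, fun j hj => ?_⟩,
      ext_pair (fun j => ?_) fun j => ?_⟩
    · have := Λ.antitone_parts 0 hij
      have := h1 i
      have := ha0 j
      simp only [Finsupp.tsub_apply, ones_apply]
      split_ifs <;> omega
    · have := Λ.antitone_parts 1 hij
      have := h2 i
      have := hb0 j
      simp only [Finsupp.tsub_apply, ones_apply]
      split_ifs <;> omega
    · have := Λ.parts_one_le j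
      have := h1 j
      have := hb0 j
      simp only [Finsupp.tsub_apply, ones_apply]
      split_ifs <;> omega
    · have := Λ.parts_zero_add_four_le j
      have := h2 j
      have := ha0 (j + 4)
      simp only [Finsupp.tsub_apply, ones_apply]
      split_ifs <;> omega
    · change Λ.parts 0 j - ones a j = Λ.parts 0 0 - ones a 0
      rw [ones_apply, ones_apply, if_pos hj, if_pos ha, h1 j hj]
    · change Λ.parts 1 j - ones b j = Λ.parts 0 0 - ones a 0
      rw [ones_apply, ones_apply, if_pos hj, if_pos ha, h2 j hj]
    · rw [addOnes_parts_zero]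
      change Λ.parts 0 j - ones a j + _ = _
      have := h1 j
      rw [ones_apply]
      split_ifs <;> omega
    · rw [addOnes_parts_one]
      change Λ.parts 1 j - ones b j + _ = _
      have := h2 j
      rw [ones_apply]
      split_ifs <;> omega

end AddOnes

/-- The generating function of a set of cylindric partitions with profile `(4, 0)`. -/
noncomputable def genFun (q : ℂ) (S : Set (CylindricPartition ![4, 0])) : ℂ :=
  ∑' Λ, S.indicator (fun Λ => q ^ Λ.size) Λ

/-! ### Relations between generating functions, and their limits. -/

section GenFun

variable {q : ℂ} (hq : ‖q‖ < 1)
include hq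

theorem summable_indicator (S : Set (CylindricPartition ![4, 0])) :
    Summable (S.indicator fun Λ => q ^ Λ.size) :=
  (summable_norm_pow_size hq).of_norm.indicator S

theorem genFun_union (S T : Set (CylindricPartition ![4, 0])) :
    genFun q (S ∪ T) = genFun q S + genFun q T - genFun q (S ∩ T) := by
  rw [eq_sub_iff_add_eq, genFun, genFun, genFun, genFun,
    ← (summable_indicator hq _).tsum_add (summable_indicator hq _),
    ← (summable_indicator hq _).tsum_add (summable_indicator hq _)]
  refine tsum_congr fun Λ => ?_
  exact Set.indicator_union_add_inter_apply _ S T Λ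

theorem genFun_strictLeading (a b : ℕ) :
    genFun q (strictLeading a b) = genFun q (leading (a + 1) b) + genFun q (leading a (b + 1)) -
      genFun q (leading (a + 1) (b + 1)) := by
  rw [strictLeading, genFun_union hq, leading_inter]

theorem genFun_leading {a b : ℕ} (ha : 0 < a) (hab : b ≤ a) (hab' : a ≤ b + 4) :
    genFun q (strictLeading a b) = (1 - q ^ (a + b)) * genFun q (leading a b) := by
  have h1 : genFun q (leading a b \ strictLeading a b) =
      q ^ (a + b) * genFun q (leading a b) := by
    rw [← addOnes_image hab hab' ha, genFun, genFun, ← tsum_subtype, ← tsum_subtype,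
      tsum_image (fun Λ => q ^ Λ.size) (addOnes_injective hab hab').injOn, ← tsum_mul_left]
    refine tsum_congr fun Λ => ?_
    rw [size_addOnes, pow_add, mul_comm]
  have h2 : genFun q (leading a b) =
      genFun q (strictLeading a b) + genFun q (leading a b \ strictLeading a b) := by
    have h := genFun_union hq (strictLeading a b) (leading a b \ strictLeading a b)
    rw [Set.union_sdiff_cancel (strictLeading_subset a b), Set.inter_sdiff_self] at h
    simpa [genFun] using h
  linear_combination -h2 - h1

/-- For each fixed nonzero member, some entry of the first row vanishes, so it drops out of `leading
m 0` for large m. Only the empty one survives, and dominated convergence applies. -/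
theorem tendsto_genFun {S : ℕ → Set (CylindricPartition ![4, 0])} (h : ∀ m, S m ⊆ leading m 0)
    (h0 : ∀ m, ofPair 0 0 antitone_const antitone_const (fun _ => le_rfl) (fun _ => le_rfl) ∈ S m) :
    Tendsto (fun m => genFun q (S m)) atTop (𝓝 1) := by
  classical
  set Z : CylindricPartition ![4, 0] :=
    ofPair 0 0 antitone_const antitone_const (fun _ => le_rfl) (fun _ => le_rfl) with hZ
  have hZ0 : ∀ i, Z.parts i = 0 := fun i => by fin_cases i <;> rfl
  have hlim : Tendsto (fun m => genFun q (S m)) atTop (𝓝 (∑' Λ, if Λ = Z then (1 : ℂ) else 0)) := by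
    refine tendsto_tsum_of_dominated_convergence (summable_norm_pow_size hq) (fun Λ => ?_)
      (Eventually.of_forall fun m Λ => norm_indicator_le_norm_self _ _)
    split_ifs with hΛ
    · subst hΛ
      refine tendsto_const_nhds.congr fun m => ?_
      rw [Set.indicator_of_mem (h0 m)]
      simp [size_eq, hZ0]
    · obtain ⟨N, hN⟩ := (Λ.parts 0).exists_forall_le_eq_zero
      refine tendsto_const_nhds.congr' ?_
      filter_upwards [eventually_gt_atTop N] with m hm
      rw [Set.indicator_of_notMem]
      intro hmem
      have h00 : Λ.parts 0 0 = 0 := by rw [← (h m hmem).1 N hm, hN N le_rfl]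
      refine hΛ (ext_pair (fun j => ?_) fun j => ?_)
      · have := Λ.parts_zero_le j
        simp only [hZ0, Finsupp.zero_apply]; omega
      · have := Λ.parts_one_le_zero j
        simp only [hZ0, Finsupp.zero_apply]; omega
  simpa using hlim

theorem tendsto_genFun_strictLeading (f g : ℕ → ℕ) (hf : ∀ m, m ≤ f m) :
    Tendsto (fun m => genFun q (strictLeading (f m) (g m))) atTop (𝓝 1) := by
  refine tendsto_genFun hq (fun m Λ hΛ => ?_) fun m => Or.inl ⟨fun j _ => rfl, fun j _ => rfl⟩
  have := strictLeading_subset _ _ hΛ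
  exact ⟨fun j hj => this.1 j (hj.trans_le (hf m)), fun j hj => absurd hj (Nat.not_lt_zero j)⟩

end GenFun

/-- The normalized generating function `(q^(a+b+1); q)_∞ * genFun q (strictLeading a b)`. -/
noncomputable def normGenFun (q : ℂ) (a b : ℕ) : ℂ :=
  qPochTail q q (a + b) * genFun q (strictLeading a b)

/-! ### The linear system on the strip and its solution. -/

section NormGenFun

variable {q : ℂ} (hq : ‖q‖ < 1)
include hq

theorem qPochTail_mul_genFun_leading {a b s : ℕ} (hs : a + b = s + 1) (ha : 0 < a) (hab : b ≤ a)
    (hab' : a ≤ b + 4) :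
    qPochTail q q s * genFun q (leading a b) = normGenFun q a b := by
  rw [normGenFun, genFun_leading hq ha hab hab', qPochTail_eq hq hq s, hs]
  ring

theorem qPochTail_mul_genFun_leading' {a b s : ℕ} (hs : a + b = s + 2) (ha : 0 < a) (hab : b ≤ a)
    (hab' : a ≤ b + 4) :
    qPochTail q q s * genFun q (leading a b) = (1 - q ^ (s + 1)) * normGenFun q a b := by
  rw [← qPochTail_mul_genFun_leading hq (s := s + 1) hs ha hab hab', qPochTail_eq hq hq s]
  ring

theorem normGenFun_diag (a : ℕ) : normGenFun q a a = normGenFun q (a + 1) a := by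
  rw [← qPochTail_mul_genFun_leading hq (a := a + 1) (s := a + a) (by ring) (by omega) (by omega)
    (by omega), normGenFun, strictLeading, Set.union_eq_left.mpr (leading_diag_subset a)]

theorem normGenFun_add_four (b : ℕ) : normGenFun q (b + 4) b = normGenFun q (b + 4) (b + 1) := by
  rw [← qPochTail_mul_genFun_leading hq (a := b + 4) (b := b + 1) (s := b + 4 + b) (by ring)
    (by omega) (by omega) (by omega), normGenFun, strictLeading,
    Set.union_eq_right.mpr (leading_add_four_subset b)]

/-- Inclusion–exclusion inside the strip. The two shapes with one more cell absorb the tail exactly;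
the shape with two more cells leaves the factor 1 - q^(a+b+1). -/
theorem normGenFun_eq {a b : ℕ} (h : b < a) (h' : a < b + 4) :
    normGenFun q a b = normGenFun q (a + 1) b + normGenFun q a (b + 1) -
      (1 - q ^ (a + b + 1)) * normGenFun q (a + 1) (b + 1) := by
  rw [← qPochTail_mul_genFun_leading hq (a := a + 1) (s := a + b) (by ring) (by omega) (by omega)
    (by omega), ← qPochTail_mul_genFun_leading hq (b := b + 1) (s := a + b) (by ring) (by omega)
    (by omega) (by omega), ← qPochTail_mul_genFun_leading' hq (a := a + 1) (b := b + 1)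
    (s := a + b) (by ring) (by omega) (by omega) (by omega), normGenFun, genFun_strictLeading hq]
  ring

theorem tendsto_normGenFun (f g : ℕ → ℕ) (hf : ∀ m, m ≤ f m) :
    Tendsto (fun m => normGenFun q (f m) (g m)) atTop (𝓝 1) := by
  have h1 : Tendsto (fun m => f m + g m) atTop atTop :=
    tendsto_atTop_mono (fun m => (hf m).trans (Nat.le_add_right _ _)) tendsto_id
  simpa [normGenFun] using ((tendsto_qPochTail hq hq).comp h1).mul (tendsto_genFun_strictLeading hq f g hf)

/-- The symmetry between profiles `(3, 1)` and `(1, 3)`. -/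
theorem normGenFun_symm (m : ℕ) : normGenFun q (m + 3) m = normGenFun q (m + 2) (m + 1) := by
  have hlim := (tendsto_normGenFun hq (fun m => m + 3) id fun m => by omega).sub
    (tendsto_normGenFun hq (fun m => m + 2) (fun m => m + 1) fun m => by omega)
  rw [sub_self] at hlim
  refine sub_eq_zero.mp (eq_zero_of_norm_le_succ (fun m => ?_) hlim m)
  have e1 := normGenFun_eq hq (a := m + 3) (b := m) (by omega) (by omega)
  have e2 := normGenFun_eq hq (a := m + 2) (b := m + 1) (by omega) (by omega)
  have e3 := normGenFun_add_four hq m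
  have e4 := normGenFun_diag hq (m + 2)
  -- H(m+3,m+1) occurs in both `e1` and `e2` and cancels; the edge relations merge the rest. The
  -- difference is thus q^(2m+4) times its successor, so its norm cannot decrease with m, yet it
  -- tends to 0.
  have key : normGenFun q (m + 3) m - normGenFun q (m + 2) (m + 1) =
      q ^ (2 * m + 4) * (normGenFun q (m + 4) (m + 1) - normGenFun q (m + 3) (m + 2)) := by
    simp only [add_assoc, Nat.reduceAdd] at e1 e2 e3 e4
    rw [show m + (3 + (m + 1)) = 2 * m + 4 by ring] at e1
    rw [show m + (2 + (m + 2)) = 2 * m + 4 by ring] at e2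
    linear_combination e1 - e2 + e3 - e4
  simp only [id]
  rw [key, norm_mul]
  refine mul_le_of_le_one_left (norm_nonneg _) ?_
  rw [norm_pow]
  exact pow_le_one₀ (norm_nonneg _) hq.le

theorem normGenFun_recurrence (m : ℕ) :
    normGenFun q m m = (1 + (q ^ (2 * m + 2) + q ^ (2 * m + 3))) * normGenFun q (m + 1) (m + 1) +
      q ^ (2 * m + 4) * (1 - q ^ (2 * m + 3)) * normGenFun q (m + 2) (m + 2) := by
  have d0 := normGenFun_diag hq m
  have d1 := normGenFun_diag hq (m + 1)
  have d2 := normGenFun_diag hq (m + 2)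
  have e0 := normGenFun_eq hq (a := m + 1) (b := m) (by omega) (by omega)
  have e1 := normGenFun_eq hq (a := m + 2) (b := m) (by omega) (by omega)
  have e2 := normGenFun_eq hq (a := m + 2) (b := m + 1) (by omega) (by omega)
  have s0 := normGenFun_symm hq m
  simp only [add_assoc, Nat.reduceAdd] at d0 d1 d2 e0 e1 e2 s0
  rw [show m + (1 + (m + 1)) = 2 * m + 2 by ring] at e0
  rw [show m + (2 + (m + 1)) = 2 * m + 3 by ring] at e1
  rw [show m + (2 + (m + 2)) = 2 * m + 4 by ring] at e2
  -- The symmetry `s0` removes H(m+3,m), the multiple of `e2` removes H(m+3,m+1), and `d1`, `d2`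
  -- move the remaining values to the diagonal.
  linear_combination d0 + e0 + e1 + s0 + (1 - q ^ (2 * m + 3)) * e2 -
    (q ^ (2 * m + 2) + q ^ (2 * m + 3)) * d1 +
    (1 - q ^ (2 * m + 3)) * (1 - q ^ (2 * m + 4)) * d2

theorem tsum_pow_size : qPochInf q q * ∑' Λ : CylindricPartition ![4, 0], q ^ Λ.size =
    seriesSum q 0 := by
  rw [← eq_seriesSum_of_recurrence hq (normGenFun_recurrence hq)
    (tendsto_normGenFun hq id id fun m => le_rfl) 0, normGenFun, strictLeading_zero, genFun,
    qPochTail_zero, Set.indicator_univ]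

end NormGenFun

end CylindricPartition

theorem mainTheorem3 (q : ℂ) (hq : ‖q‖ < 1) :
    Summable (fun n : ℕ =>
      q ^ (n * (n + 1)) * qPoch (-q ^ 2) (q ^ 2) n /
        (qPoch (-q ^ 3) (q ^ 2) n * qPoch (q ^ 2) (q ^ 2) n)) ∧
    HasSum (fun Λ : CylindricPartition ![4, 0] => q ^ Λ.size)
      ((∑' n : ℕ, q ^ (n * (n + 1)) * qPoch (-q ^ 2) (q ^ 2) n /
          (qPoch (-q ^ 3) (q ^ 2) n * qPoch (q ^ 2) (q ^ 2) n)) *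
        (qPochInf (-q ^ 3) (q ^ 2) / qPochInf q q)) := by
  have hP : qPochInf (-q ^ 3) (q ^ 2) ≠ 0 :=
    qPochInf_ne_zero (norm_neg_pow_lt_one hq three_ne_zero) (norm_pow_lt_one hq two_ne_zero)
  have hs := (summable_seriesTerm hq 0).congr seriesTerm_zero
  refine ⟨(summable_mul_right_iff hP).mp hs, ?_⟩
  have h := CylindricPartition.tsum_pow_size hq
  simp_rw [seriesSum, seriesTerm_zero, tsum_mul_right] at h
  rw [← mul_div_assoc, ← h, mul_div_cancel_left₀ _ (qPochInf_ne_zero hq hq)]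
  exact (CylindricPartition.summable_norm_pow_size hq).of_norm.hasSum
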